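/- Fix $\varepsilon>0$ and put $c(\varepsilon)=1/\sqrt{2\cosh(\varepsilon)-2}$. For an irrational $\alpha\in\mathbb R/\mathbb Z$ define the boundary function $\mathscr B_\alpha:[0,\infty)\to\mathbb R$ (of the Margulis region of the screw translation $(r,\theta,z,t)\mapsto(r,\theta+\alpha,z+1,t)$ of hyperbolic $4$-space) by $$\mathscr B_\alpha(r)=\inf_{j\ge 1}\ c(\varepsilon)\sqrt{4\sin^2(\pi j\alpha)\,r^2+j^2},$$ where $j$ runs over the positive integers. Say that $\alpha$ is Diophantine of exponent $\nu$ if there is a constant $K>0$ such that $|\alpha-p/q|>K/|q|^{\nu}$ for every rational number $p/q$. (i) There is a constant $C>0$, depending on $\varepsilon$ but not on $\alpha$, such that for every irrational $\alpha$ there is $R$ (which may depend on $\varepsilon$ and $\alpha$) with $\mathscr B_\alpha(r)\le C\sqrt r$ for all $r\ge R$. (ii) If $\alpha$ is irrational and Diophantine of exponent $\nu$ for a real number $\nu\ge 2$, then there are constants $c>0$ and $R$, which may depend on $\varepsilon$, $\alpha$ and $\nu$, with $\mathscr B_\alpha(r)\ge c\,r^{1/(2\nu-2)}$ for all $r\ge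 R$. -/

import Mathlib

open Filter

noncomputable section

/-- The normalizing constant `c(ε) = 1 / √(2 cosh ε - 2)`. -/
def margulisConst (ε : ℝ) : ℝ := 1 / Real.sqrt (2 * Real.cosh ε - 2)

/-- `u_{α,j}(r) = c(ε) √(4 sin²(π j α) r² + j²)`. A point `(r, θ, z, t)` of the upper half-space
model of hyperbolic 4-space is moved a distance less than `ε` by the `j`-th iterate of the screw
translation `(r, θ, z, t) ↦ (r, θ + α, z + 1, t)` (angles in full turns) exactly when
`t > u_{α,j}(r)`. It depends only on the class of `α` in `ℝ / ℤ`. -/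
def uFun (ε α : ℝ) (j : ℕ) (r : ℝ) : ℝ :=
  margulisConst ε * Real.sqrt (4 * Real.sin (Real.pi * (j : ℝ) * α) ^ 2 * r ^ 2 + (j : ℝ) ^ 2)

/-- The boundary function `𝓑_α(r) = inf_{j ≥ 1} u_{α,j}(r)` of the Margulis region (an infimum of
nonnegative reals); it is of interest for `r ≥ 0`. -/
def boundaryFun (ε α r : ℝ) : ℝ := ⨅ j : ℕ+, uFun ε α (j : ℕ) r

/-- `α` is Diophantine of exponent `ν`: there is `K > 0` with `|α - p/q| > K / |q|^ν` for every
rational number `p/q`. The condition is invariant under `α ↦ α + 1`, and forces `α` to be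
irrational. -/
def IsDiophantine (α ν : ℝ) : Prop :=
  ∃ K : ℝ, 0 < K ∧ ∀ p q : ℤ, q ≠ 0 → K / |(q : ℝ)| ^ ν < |α - (p : ℝ) / (q : ℝ)|

end

/-!
After factoring out `margulisConst ε > 0`, the value `uFun ε α j r` is comparable to
`max (‖jα‖ * r) j`, where `‖x‖ = |x - round x|` is the distance to the nearest integer, because
`|sin (π x)|` lies between `2 ‖x‖` and `π ‖x‖`.

For the upper bound, Dirichlet's theorem with `n = ⌊√r⌋` gives `1 ≤ j ≤ √r` with
`‖jα‖ ≤ 1 / √r`, so both terms are `O(√r)` with an absolute constant.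

For the lower bound, the Diophantine condition says `‖jα‖ > K * j ^ (1 - ν)`. If `j ≥ r ^ (1 / ν)`
the term `j` is large; otherwise `j ^ (1 - ν) * r ≥ r ^ (1 / ν)`. Hence `boundaryFun ε α r` is at
least a constant times `r ^ (1 / ν)`, and `1 / ν ≥ 1 / (2 * ν - 2)` for `ν ≥ 2`.
-/

theorem margulisConst_pos {ε : ℝ} (hε : 0 < ε) : 0 < margulisConst ε := by
  have h : 1 < Real.cosh ε := Real.one_lt_cosh.2 hε.ne'
  exact one_div_pos.2 (Real.sqrt_pos.2 (by linarith))

theorem uFun_nonneg {ε : ℝ} (hε : 0 < ε) (α : ℝ) (j : ℕ) (r : ℝ) : 0 ≤ uFun ε α j r :=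
  mul_nonneg (margulisConst_pos hε).le (Real.sqrt_nonneg _)

theorem boundaryFun_le_uFun {ε : ℝ} (hε : 0 < ε) (α r : ℝ) {j : ℕ} (hj : 0 < j) :
    boundaryFun ε α r ≤ uFun ε α j r :=
  ciInf_le ⟨0, Set.forall_mem_range.2 fun k : ℕ+ => uFun_nonneg hε α k r⟩ (⟨j, hj⟩ : ℕ+)

theorem abs_sin_pi_mul_sub_round (x : ℝ) :
    |Real.sin (Real.pi * (x - round x))| = |Real.sin (Real.pi * x)| := by
  rw [show Real.pi * (x - round x) = Real.pi * x - (round x : ℤ) * Real.pi by ring,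
    Real.sin_sub_int_mul_pi, abs_mul, abs_zpow, abs_neg, abs_one, one_zpow, one_mul]

theorem abs_sin_pi_mul_le (x : ℝ) : |Real.sin (Real.pi * x)| ≤ Real.pi * |x - round x| := by
  rw [← abs_sin_pi_mul_sub_round]
  refine Real.abs_sin_le_abs.trans_eq ?_
  rw [abs_mul, abs_of_pos Real.pi_pos]

theorem two_mul_abs_sub_round_le (x : ℝ) : 2 * |x - round x| ≤ |Real.sin (Real.pi * x)| := by
  have hpi := Real.pi_pos
  have habs : |Real.pi * (x - round x)| = Real.pi * |x - round x| := by
    rw [abs_mul, abs_of_pos hpi]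
  have h := Real.mul_abs_le_abs_sin (x := Real.pi * (x - round x)) (by
    rw [habs]; nlinarith [abs_sub_round x])
  rw [abs_sin_pi_mul_sub_round, habs] at h
  calc 2 * |x - round x| = 2 / Real.pi * (Real.pi * |x - round x|) := by field_simp
    _ ≤ _ := h

theorem boundaryFun_le_mul_sqrt {ε : ℝ} (hε : 0 < ε) (α : ℝ) {r : ℝ} (hr : 1 ≤ r) :
    boundaryFun ε α r ≤ margulisConst ε * Real.sqrt (4 * Real.pi ^ 2 + 1) * Real.sqrt r := by
  have hr0 : 0 ≤ r := by linarith
  have hs : 1 ≤ Real.sqrt r := Real.one_le_sqrt.2 hr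
  have hs2 : Real.sqrt r ^ 2 = r := Real.sq_sqrt hr0
  obtain ⟨j, hj0, hjn, hj⟩ :=
    Real.exists_nat_abs_mul_sub_round_le α (Nat.floor_pos.2 hs)
  have hjs : (j : ℝ) ≤ Real.sqrt r :=
    (Nat.cast_le.2 hjn).trans (Nat.floor_le (Real.sqrt_nonneg r))
  have hsin : |Real.sin (Real.pi * j * α)| * Real.sqrt r ≤ Real.pi := by
    have h1 : |j * α - round (j * α)| ≤ 1 / Real.sqrt r :=
      hj.trans (one_div_le_one_div_of_le (by linarith) (Nat.lt_floor_add_one _).le)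
    rw [le_div_iff₀ (by linarith)] at h1
    rw [mul_assoc Real.pi]
    calc _ ≤ Real.pi * |j * α - round (j * α)| * Real.sqrt r := by
            gcongr; exact abs_sin_pi_mul_le _
      _ ≤ Real.pi * 1 := by rw [mul_assoc]; gcongr
      _ = Real.pi := mul_one _
  have hsin2 : Real.sin (Real.pi * j * α) ^ 2 * r ≤ Real.pi ^ 2 := by
    have := pow_le_pow_left₀ (by positivity) hsin 2
    rwa [mul_pow, sq_abs, hs2] at this
  have hj2 : (j : ℝ) ^ 2 ≤ r := hs2 ▸ pow_le_pow_left₀ (Nat.cast_nonneg j) hjs 2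
  refine (boundaryFun_le_uFun hε α r hj0).trans ?_
  rw [uFun, mul_assoc (margulisConst ε), ← Real.sqrt_mul (by positivity)]
  refine mul_le_mul_of_nonneg_left (Real.sqrt_le_sqrt ?_) (margulisConst_pos hε).le
  nlinarith [mul_le_mul_of_nonneg_right hsin2 hr0]

theorem mul_rpow_lt_abs_sub_round {α ν K : ℝ}
    (h : ∀ p q : ℤ, q ≠ 0 → K / |(q : ℝ)| ^ ν < |α - (p : ℝ) / (q : ℝ)|) {j : ℕ} (hj : 0 < j) :
    K * (j : ℝ) ^ (1 - ν) < |j * α - round (j * α)| := by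
  have hj' : (0 : ℝ) < j := Nat.cast_pos.2 hj
  have h1 := mul_lt_mul_of_pos_left (h (round (j * α)) j (by exact_mod_cast hj.ne')) hj'
  rw [Int.cast_natCast, abs_of_pos hj'] at h1
  calc K * (j : ℝ) ^ (1 - ν) = j * (K / (j : ℝ) ^ ν) := by
        rw [Real.rpow_sub hj', Real.rpow_one]; ring
    _ < j * |α - round (j * α) / j| := h1
    _ = |j * α - round (j * α)| := by
        nth_rewrite 1 [← abs_of_pos hj']
        rw [← abs_mul, mul_sub, mul_div_cancel₀ _ hj'.ne']

/-- The two terms under the square root balance at `j = r ^ (1 / ν)`, which makes `1 / ν` the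
natural exponent of the lower bound. -/
theorem mul_rpow_le_boundaryFun {ε : ℝ} (hε : 0 < ε) {α ν K : ℝ} (hν : 1 ≤ ν) (hK : 0 < K)
    (h : ∀ p q : ℤ, q ≠ 0 → K / |(q : ℝ)| ^ ν < |α - (p : ℝ) / (q : ℝ)|) {r : ℝ} (hr : 0 < r) :
    margulisConst ε * min 1 (4 * K) * r ^ (1 / ν) ≤ boundaryFun ε α r := by
  refine le_ciInf fun j => ?_
  have hj : (0 : ℝ) < (j : ℕ) := Nat.cast_pos.2 j.pos
  have hR : 0 < r ^ (1 / ν) := Real.rpow_pos_of_pos hr _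
  rw [uFun, mul_assoc]
  refine mul_le_mul_of_nonneg_left ?_ (margulisConst_pos hε).le
  rcases le_or_gt (r ^ (1 / ν)) (j : ℕ) with hle | hlt
  · calc min 1 (4 * K) * r ^ (1 / ν) ≤ 1 * r ^ (1 / ν) := by gcongr; exact min_le_left _ _
      _ ≤ (j : ℕ) := by rwa [one_mul]
      _ ≤ _ := Real.le_sqrt_of_sq_le (le_add_of_nonneg_left (by positivity))
  · have hpow : r ^ (1 / ν) ≤ ((j : ℕ) : ℝ) ^ (1 - ν) * r := by
      calc r ^ (1 / ν) = (r ^ (1 / ν)) ^ (1 - ν) * r := by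
            rw [← Real.rpow_mul hr.le]
            nth_rewrite 3 [← Real.rpow_one r]
            rw [← Real.rpow_add hr]
            congr 1
            field_simp
            ring
        _ ≤ _ := mul_le_mul_of_nonneg_right
            (Real.rpow_le_rpow_of_nonpos hj hlt.le (by linarith)) hr.le
    have hsin : 2 * (K * ((j : ℕ) : ℝ) ^ (1 - ν)) ≤ |Real.sin (Real.pi * (j : ℕ) * α)| := by
      rw [mul_assoc Real.pi]
      exact (mul_le_mul_of_nonneg_left (mul_rpow_lt_abs_sub_round h j.pos).le
        zero_le_two).trans (two_mul_abs_sub_round_le _)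
    calc min 1 (4 * K) * r ^ (1 / ν) ≤ 4 * K * (((j : ℕ) : ℝ) ^ (1 - ν) * r) :=
          mul_le_mul (min_le_right _ _) hpow hR.le (by positivity)
      _ = 2 * (2 * (K * ((j : ℕ) : ℝ) ^ (1 - ν))) * r := by ring
      _ ≤ 2 * |Real.sin (Real.pi * (j : ℕ) * α)| * r := by gcongr
      _ ≤ _ := Real.le_sqrt_of_sq_le (by
          rw [mul_pow, mul_pow, sq_abs]
          nlinarith [sq_nonneg ((j : ℕ) : ℝ)])

theorem theoremA (ε : ℝ) (hε : 0 < ε) :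
    (∃ C : ℝ, 0 < C ∧ ∀ α : ℝ, Irrational α →
      ∀ᶠ r : ℝ in atTop, boundaryFun ε α r ≤ C * Real.sqrt r) ∧
    (∀ α ν : ℝ, Irrational α → 2 ≤ ν → IsDiophantine α ν →
      ∃ c : ℝ, 0 < c ∧ ∀ᶠ r : ℝ in atTop, c * r ^ (1 / (2 * ν - 2)) ≤ boundaryFun ε α r) := by
  have hc := margulisConst_pos hε
  refine ⟨⟨margulisConst ε * Real.sqrt (4 * Real.pi ^ 2 + 1), by positivity, fun α _ => ?_⟩, ?_⟩
  · filter_upwards [eventually_ge_atTop 1] with r hr using boundaryFun_le_mul_sqrt hε α hr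
  · rintro α ν - hν ⟨K, hK, h⟩
    refine ⟨margulisConst ε * min 1 (4 * K), by positivity, ?_⟩
    filter_upwards [eventually_ge_atTop 1] with r hr
    refine le_trans ?_ (mul_rpow_le_boundaryFun hε (by linarith) hK h (by linarith))
    have hexp : 1 / (2 * ν - 2) ≤ 1 / ν := one_div_le_one_div_of_le (by linarith) (by linarith)
    exact mul_le_mul_of_nonneg_left (Real.rpow_le_rpow_of_exponent_le hr hexp) (by positivity)
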